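/- Theorem (Generalized Löwner–Heinz). Let $n\in\mathbb{N}$, let $S^+_n$ be the set of real symmetric positive definite $n\times n$ matrices, and fix $\mu\in(0,n)$. For $\Sigma\in S^+_n$ let $$\mathcal{K}(\Sigma)=\{X\in\mathbb{R}^{n\times n}: X^T=X,\ (\operatorname{tr}\Sigma^{-1}X)^2-\mu\operatorname{tr}(\Sigma^{-1}X\Sigma^{-1}X)\geq 0,\ \operatorname{tr}\Sigma^{-1}X\geq 0\}.$$ For $\Sigma_1,\Sigma_2\in S^+_n$ write $\Sigma_1\prec_{\mathcal{K}}\Sigma_2$ if there is a piecewise smooth curve $\gamma:[0,1]\to S^+_n$ (continuous, and $C^\infty$ on each of finitely many closed intervals that make up $[0,1]$) with $\gamma(0)=\Sigma_1$, $\gamma(1)=\Sigma_2$ and $\gamma'(t)\in\mathcal{K}(\gamma(t))$ for every $t\in[0,1]$ at which the derivative (one-sided at $t=0,1$) exists. Write $\Sigma_1\leq_{\mathcal{K}}\Sigma_2$ if $\Sigma_2$ lies in the closure in $S^+_n$ of $\{Z\in S^+_n:\Sigma_1\prec_{\mathcal{K}}Z\}$. Then for every $r\in[0,1]$ the map $\Sigma\mapsto\Sigma^r$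 on $S^+_n$ is monotone with respect to both orders: for all $\Sigma_1,\Sigma_2\in S^+_n$, $$\Sigma_1\prec_{\mathcal{K}}\Sigma_2\implies\Sigma_1^r\prec_{\mathcal{K}}\Sigma_2^r \qquad\text{and}\qquad \Sigma_1\leq_{\mathcal{K}}\Sigma_2\implies\Sigma_1^r\leq_{\mathcal{K}}\Sigma_2^r.$$ -/

import Mathlib

open scoped ContDiff

/-- The set of real symmetric positive definite matrices of size `n`, with the topology induced
from the space of all matrices. -/
abbrev PosDefMatrix (n : ℕ) : Type := {A : Matrix (Fin n) (Fin n) ℝ // A.PosDef}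

/-- The quadratic affine-invariant cone field with parameter `μ`: the cone at `A` consists of the
tangent vectors at `A` (symmetric matrices) `X` with
`(tr (A⁻¹ X))² - μ tr (A⁻¹ X A⁻¹ X) ≥ 0` and `tr (A⁻¹ X) ≥ 0`. -/
def quadraticConeField (n : ℕ) (μ : ℝ) (A : PosDefMatrix n) : Set (Matrix (Fin n) (Fin n) ℝ) :=
  {X | X.IsSymm ∧
    0 ≤ (A.1⁻¹ * X).trace ^ 2 - μ * (A.1⁻¹ * X * A.1⁻¹ * X).trace ∧
    0 ≤ (A.1⁻¹ * X).trace}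

section Conal

-- The entrywise sup norm; in finite dimension smoothness does not depend on the choice of norm.
open scoped Matrix.Norms.Elementwise

/-- `γ` is piecewise smooth on `[0,1]`: it is continuous there, and `[0,1]` is divided by finitely
many points into closed intervals on each of which `γ` is `C^∞`. -/
def IsPiecewiseSmooth {n : ℕ} (γ : ℝ → Matrix (Fin n) (Fin n) ℝ) : Prop :=
  ContinuousOn γ (Set.Icc 0 1) ∧
    ∃ (k : ℕ) (t : ℕ → ℝ), Monotone t ∧ t 0 = 0 ∧ t k = 1 ∧
      ∀ i < k, ContDiffOn ℝ ∞ γ (Set.Icc (t i) (t (i + 1)))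

/-- `γ`, restricted to `[0,1]`, is a conal curve in the positive definite matrices for the cone
field `K`: it is piecewise smooth and `γ' t ∈ K (γ t)` whenever the derivative exists (the
one-sided derivative if `t = 0` or `t = 1`). -/
def IsConalCurve {n : ℕ} (K : PosDefMatrix n → Set (Matrix (Fin n) (Fin n) ℝ))
    (γ : ℝ → Matrix (Fin n) (Fin n) ℝ) : Prop :=
  IsPiecewiseSmooth γ ∧
    ∀ t ∈ Set.Icc (0 : ℝ) 1, ∃ h : (γ t).PosDef,
      ∀ X, HasDerivWithinAt γ X (Set.Icc 0 1) t → X ∈ K ⟨γ t, h⟩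

end Conal

/-- The conal order of the cone field `K`: `A` is joined to `B` by a conal curve. -/
def ConalLE {n : ℕ} (K : PosDefMatrix n → Set (Matrix (Fin n) (Fin n) ℝ))
    (A B : PosDefMatrix n) : Prop :=
  ∃ γ : ℝ → Matrix (Fin n) (Fin n) ℝ, IsConalCurve K γ ∧ γ 0 = A.1 ∧ γ 1 = B.1

/-- The closure of the conal order: `B` lies in the closure, within the positive definite matrices,
of the set of all `Z` that follow `A` in the conal order. -/
def ClosedConalLE {n : ℕ} (K : PosDefMatrix n → Set (Matrix (Fin n) (Fin n) ℝ))
    (A B : PosDefMatrix n) : Prop :=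
  B ∈ closure {Z : PosDefMatrix n | ConalLE K A Z}

section Power

open scoped MatrixOrder

theorem posDef_rpow {n : ℕ} {A : Matrix (Fin n) (Fin n) ℝ} (hA : A.PosDef) (r : ℝ) :
    (A ^ r).PosDef := by
  have h : IsStrictlyPositive A := Matrix.isStrictlyPositive_iff_posDef.mpr hA
  exact Matrix.isStrictlyPositive_iff_posDef.mp (IsStrictlyPositive.rpow A r h)

/-- The power map `A ↦ A ^ r` (functional calculus) on positive definite matrices. -/
noncomputable def posDefPow {n : ℕ} (r : ℝ) (A : PosDefMatrix n) : PosDefMatrix n :=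
  ⟨A.1 ^ r, posDef_rpow A.2 r⟩

end Power

/-! ### Local analyticity of the matrix power -/

section AnalyticPower

open scoped MatrixOrder Matrix.Norms.L2Operator Topology

/-! The image of a conal curve under the power map is again conal. In an orthonormal eigenbasis of
`γ t`, with eigenvalues `d i`, the derivative of `γ ^ r` is the derivative `X` of `γ` with each
entry `X i j` multiplied by the divided difference of `x ^ r` at `d i`, `d j`
(`hasDerivWithinAt_dotProduct_rpow_mulVec`). The linear trace `∑ X i i / d i` is therefore
multiplied by exactly `r`. The quadratic trace `∑ (X i j)² / (d i * d j)` grows by at most `r ^ 2`,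
term by term (`dslope_rpow_sq_div_le`); in logarithmic coordinates this says `|sinh (r z)| ≤ r |sinh
z|`. As `μ ≥ 0`, both cone inequalities survive (`mem_quadraticConeField_rpow`). Piecewise
smoothness persists because the power is locally a binomial series (`exists_analyticAt_eq_rpow`).
The closed order follows by continuity. -/

theorem hasSum_cfc_of_hasSum {n : ℕ} {A : Matrix (Fin n) (Fin n) ℝ} (hA : A.IsHermitian)
    {f : ℕ → ℝ → ℝ} {g : ℝ → ℝ} (h : ∀ x ∈ spectrum ℝ A, HasSum (fun k => f k x) (g x)) :
    HasSum (fun k => cfc (f k) A) (cfc g A) := by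
  simp only [hA.cfc_eq, Matrix.IsHermitian.cfc, Unitary.conjStarAlgAut_apply]
  refine HasSum.mul_right _ (HasSum.mul_left _ (HasSum.matrix_diagonal ?_))
  rw [Pi.hasSum]
  intro i
  simpa using h _ (hA.eigenvalues_mem_spectrum_real i)

theorem one_le_radius_binomialSeries (𝔸 : Type*) [NormedRing 𝔸] [NormedAlgebra ℝ 𝔸] (r : ℝ) :
    1 ≤ (binomialSeries 𝔸 r).radius := by
  refine ENNReal.le_of_forall_nnreal_lt fun s hs => ?_
  have h := (binomialSeries ℝ r).summable_norm_mul_pow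
    (hs.trans_le (binomialSeries_radius_ge_one (𝕂 := ℝ) (𝔸 := ℝ) (a := r)))
  refine FormalMultilinearSeries.le_radius_of_summable_norm _ ?_
  refine Summable.of_norm_bounded_eventually_nat h ?_
  -- Degree 0 is left out because `‖1‖` need not be 1, for instance for matrices of size 0.
  filter_upwards [Filter.eventually_gt_atTop 0] with k hk
  rw [Real.norm_of_nonneg (by positivity)]
  gcongr
  refine (FormalMultilinearSeries.ofScalars_norm_le 𝔸 _ k hk).trans ?_
  rw [binomialSeries, FormalMultilinearSeries.ofScalars_norm]

theorem continuousOn_spectrum_matrix {n : ℕ} {A : Matrix (Fin n) (Fin n) ℝ} (f : ℝ → ℝ) :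
    ContinuousOn f (spectrum ℝ A) :=
  A.finite_real_spectrum.continuousOn f

theorem cfc_const_mul_sub_one {n : ℕ} {A : Matrix (Fin n) (Fin n) ℝ} (hA : A.IsHermitian)
    (c : ℝ) : cfc (fun x : ℝ => c * x - 1) A = c • A - 1 := by
  have hAs : IsSelfAdjoint A := hA
  rw [cfc_sub (fun x : ℝ => c * x) (fun _ => 1) A, cfc_const_mul_id c A, cfc_const_one ℝ A]

/-- The scaling moves the spectrum into the open interval from 0 to 1, hence within the convergence
disc of the binomial series at 1. -/
theorem norm_smul_sub_one_lt_one {n : ℕ} {A : Matrix (Fin n) (Fin n) ℝ} (hA : A.PosDef) :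
    ‖(‖A‖ + 1)⁻¹ • A - 1‖ < 1 := by
  have hAs : IsSelfAdjoint A := hA.1
  rw [← cfc_const_mul_sub_one hA.1]
  refine norm_cfc_lt one_pos fun x hx => ?_
  have hx0 : 0 < x :=
    (Matrix.isStrictlyPositive_iff_posDef.mpr hA).spectrum_pos hx
  have hx1 : x ≤ ‖A‖ := by
    have := norm_apply_le_norm_cfc (fun x : ℝ => x) A hx
    rw [cfc_id' ℝ A] at this
    exact (le_abs_self x).trans this
  have h2 : 0 < (‖A‖ + 1)⁻¹ * x := by positivity
  have h3 : (‖A‖ + 1)⁻¹ * x < 1 := by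
    rw [inv_mul_lt_one₀ (by positivity)]; linarith
  rw [Real.norm_eq_abs, abs_lt]
  constructor <;> linarith

theorem abs_mul_sub_one_le_norm {n : ℕ} {A : Matrix (Fin n) (Fin n) ℝ} (hA : A.IsHermitian)
    (c : ℝ) {x : ℝ} (hx : x ∈ spectrum ℝ A) : |c * x - 1| ≤ ‖c • A - 1‖ := by
  have hAs : IsSelfAdjoint A := hA
  rw [← cfc_const_mul_sub_one hA]
  exact norm_apply_le_norm_cfc (fun x : ℝ => c * x - 1) A hx

theorem exists_spectrum_subset_Icc_of_posDef {n : ℕ} {A : Matrix (Fin n) (Fin n) ℝ}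
    (hA : A.PosDef) : ∃ m M : ℝ, 0 < m ∧
      ∀ᶠ B in 𝓝 A, B.IsHermitian → spectrum ℝ B ⊆ Set.Icc m M := by
  set c := (‖A‖ + 1)⁻¹
  have hc : 0 < c := by positivity
  obtain ⟨ρ, h1, h2⟩ := exists_between (norm_smul_sub_one_lt_one hA)
  have hcont : ContinuousAt (fun B : Matrix (Fin n) (Fin n) ℝ => ‖c • B - 1‖) A := by fun_prop
  refine ⟨(1 - ρ) / c, (1 + ρ) / c, div_pos (by linarith) hc, ?_⟩
  filter_upwards [hcont.eventually_lt_const h1] with B hB hBh x hx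
  have := (abs_mul_sub_one_le_norm hBh c hx).trans hB.le
  rw [abs_le] at this
  rw [Set.mem_Icc, div_le_iff₀' hc, le_div_iff₀' hc]
  constructor <;> linarith

/-- Near a positive definite matrix, the power map agrees on positive definite matrices with a
rescaled binomial series. -/
theorem exists_analyticAt_eq_rpow {n : ℕ} {A : Matrix (Fin n) (Fin n) ℝ} (hA : A.PosDef) (r : ℝ) :
    ∃ G : Matrix (Fin n) (Fin n) ℝ → Matrix (Fin n) (Fin n) ℝ, AnalyticAt ℝ G A ∧
      ∀ᶠ B in 𝓝 A, B.PosDef → B ^ r = G B := by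
  have hN := norm_smul_sub_one_lt_one hA
  set M := ‖A‖ + 1
  have hM : 0 < M := by positivity
  set p := binomialSeries (Matrix (Fin n) (Fin n) ℝ) r
  have hp : 1 ≤ p.radius := one_le_radius_binomialSeries _ r
  have hps := p.hasFPowerSeriesOnBall (one_pos.trans_le hp)
  refine ⟨fun B => M ^ r • p.sum (M⁻¹ • B - 1), ?_, ?_⟩
  · have hlin : AnalyticAt ℝ (fun B : Matrix (Fin n) (Fin n) ℝ => M⁻¹ • B - 1) A :=
      (analyticAt_id.const_smul (c := M⁻¹)).sub analyticAt_const
    have hsum : AnalyticAt ℝ p.sum (M⁻¹ • A - 1) := by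
      refine hps.analyticAt_of_mem (Metric.eball_subset_eball hp ?_)
      simpa [Metric.mem_eball, edist_zero_right, ← ofReal_norm] using hN
    exact (hsum.comp_of_eq hlin rfl).const_smul (c := M ^ r)
  · have hcont : ContinuousAt (fun B : Matrix (Fin n) (Fin n) ℝ => ‖M⁻¹ • B - 1‖) A := by fun_prop
    filter_upwards [hcont.eventually_lt_const hN] with B hB hBp
    have hBs : IsSelfAdjoint B := hBp.1
    have hBpos := Matrix.isStrictlyPositive_iff_posDef.mpr hBp
    have h1 : ∀ k : ℕ, cfc (fun x : ℝ => Ring.choose r k * (M⁻¹ * x - 1) ^ k) B =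
        Ring.choose r k • (M⁻¹ • B - 1) ^ k := fun k => by
      rw [cfc_const_mul _ _ B, cfc_pow _ _ B, cfc_const_mul_sub_one hBp.1]
    have h2 : HasSum (fun k => Ring.choose r k • (M⁻¹ • B - 1) ^ k)
        (cfc (fun x : ℝ => (1 + (M⁻¹ * x - 1)) ^ r) B) := by
      simp only [← h1]
      refine hasSum_cfc_of_hasSum hBp.1 fun x hx => ?_
      have hx1 := (abs_mul_sub_one_le_norm hBp.1 M⁻¹ hx).trans_lt hB
      have := (Real.one_add_rpow_hasFPowerSeriesOnBall_zero (a := r)).hasSum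
        (y := M⁻¹ * x - 1) (by simpa [Metric.mem_eball, edist_zero_right, ← ofReal_norm] using hx1)
      simpa only [binomialSeries_apply, List.ofFn_const, List.prod_replicate, smul_eq_mul,
        zero_add] using this
    have h3 : p.sum (M⁻¹ • B - 1) = cfc (fun x : ℝ => (1 + (M⁻¹ * x - 1)) ^ r) B := by
      rw [FormalMultilinearSeries.sum, ← h2.tsum_eq]
      simp [p]
    rw [h3, CFC.rpow_eq_cfc_real hBpos.nonneg, ← cfc_const_mul _ _ B (continuousOn_spectrum_matrix _)]
    refine cfc_congr fun x hx => ?_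
    have hx0 : 0 < x := hBpos.spectrum_pos hx
    rw [← Real.mul_rpow hM.le]
    · congr 1; field_simp; ring
    · have : 0 < M⁻¹ * x := by positivity
      linarith

end AnalyticPower

/-! ### First-order perturbation of matrix powers -/

section PowerDerivative

open scoped MatrixOrder Matrix.Norms.L2Operator Topology

theorem analyticAt_rpow_const {x : ℝ} (hx : 0 < x) (r : ℝ) :
    AnalyticAt ℝ (fun y : ℝ => y ^ r) x := by
  have h : AnalyticAt ℝ (fun y : ℝ => Real.exp (Real.log y * r)) x :=
    ((analyticAt_id.log hx).mul analyticAt_const).rexp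
  refine h.congr ?_
  filter_upwards [lt_mem_nhds hx] with y hy
  rw [Real.rpow_def_of_pos hy]

/-- The delicate case is `x = a = b`: there the first divided difference must itself be
differentiable, which its power series gives. -/
theorem continuousOn_dslope_dslope {f : ℝ → ℝ} {s : Set ℝ} (hf : ∀ x ∈ s, AnalyticAt ℝ f x)
    {a b : ℝ} (hb : b ∈ s) : ContinuousOn (dslope (dslope f a) b) s := by
  intro x hx
  refine ContinuousAt.continuousWithinAt ?_
  rcases eq_or_ne x b with rfl | hxb
  · rw [continuousAt_dslope_same]
    rcases eq_or_ne x a with rfl | hxa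
    · obtain ⟨p, hp⟩ := hf x hx
      exact hp.has_fpower_series_dslope_fslope.differentiableAt
    · exact (differentiableAt_dslope_of_ne hxa).2 (hf x hx).differentiableAt
  · rw [continuousAt_dslope_of_ne hxb]
    rcases eq_or_ne x a with rfl | hxa
    · exact continuousAt_dslope_same.2 (hf x hx).differentiableAt
    · exact (continuousAt_dslope_of_ne hxa).2 (hf x hx).continuousAt

/-- Newton interpolation at `a`, `b` with its remainder. The remainder is split so that each outer
factor meets the eigenvector of its own node. -/
theorem cfc_eq_dslope_dslope {n : ℕ} {B : Matrix (Fin n) (Fin n) ℝ} (hB : B.IsHermitian)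
    (f : ℝ → ℝ) (a b : ℝ) :
    cfc f B = f a • (1 : Matrix (Fin n) (Fin n) ℝ) + dslope f a b • (B - a • 1) +
      (B - a • 1) * cfc (dslope (dslope f a) b) B * (B - b • 1) := by
  have hBs : IsSelfAdjoint B := hB
  have hc : ∀ g : ℝ → ℝ, ContinuousOn g (spectrum ℝ B) := continuousOn_spectrum_matrix
  have h1 : ∀ c : ℝ, B - c • 1 = cfc (fun x : ℝ => x - c) B := fun c => by
    rw [cfc_sub (fun x : ℝ => x) (fun _ => c) B, cfc_id' ℝ B, cfc_const c B,
      Algebra.algebraMap_eq_smul_one]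
  have h2 : f a • (1 : Matrix (Fin n) (Fin n) ℝ) = cfc (fun _ : ℝ => f a) B := by
    rw [cfc_const _ B, Algebra.algebraMap_eq_smul_one]
  rw [h1, h1, h2, ← cfc_smul _ _ B (hc _), ← cfc_mul _ _ B (hc _) (hc _),
    ← cfc_mul _ _ B (hc _) (hc _), ← cfc_add _ _ _ (hc _) (hc _), ← cfc_add _ _ _ (hc _) (hc _)]
  refine cfc_congr fun x _ => ?_
  have e1 := sub_smul_dslope f a x
  have e2 := sub_smul_dslope (dslope f a) b x
  simp only [smul_eq_mul] at e1 e2 ⊢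
  linear_combination (a - x) * e2 - e1

/-- On these eigenvectors `B - a • 1` and `B - b • 1` act as `B - A`, so the remainder becomes
quadratic in `B - A`. -/
theorem dotProduct_cfc_mulVec_eq {n : ℕ} {A B : Matrix (Fin n) (Fin n) ℝ} (hB : B.IsHermitian)
    (f : ℝ → ℝ) {a b : ℝ} {u v : Fin n → ℝ} (hu : Matrix.vecMul u A = a • u)
    (hv : A.mulVec v = b • v) :
    u ⬝ᵥ (cfc f B).mulVec v = (f a - dslope f a b * a) * (u ⬝ᵥ v) +
      dslope f a b * (u ⬝ᵥ B.mulVec v) +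
      u ⬝ᵥ ((B - A) * cfc (dslope (dslope f a) b) B * (B - A)).mulVec v := by
  have h1 : Matrix.vecMul u (B - a • 1) = Matrix.vecMul u (B - A) := by
    rw [Matrix.vecMul_sub, Matrix.vecMul_sub, hu, Matrix.vecMul_smul, Matrix.vecMul_one]
  have h2 : (B - b • 1).mulVec v = (B - A).mulVec v := by
    rw [Matrix.sub_mulVec, Matrix.sub_mulVec, hv, Matrix.smul_mulVec, Matrix.one_mulVec]
  have h3 : u ⬝ᵥ ((B - a • 1) * cfc (dslope (dslope f a) b) B * (B - b • 1)).mulVec v =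
      u ⬝ᵥ ((B - A) * cfc (dslope (dslope f a) b) B * (B - A)).mulVec v := by
    rw [← Matrix.mulVec_mulVec, ← Matrix.mulVec_mulVec, h2, Matrix.dotProduct_mulVec u, h1,
      ← Matrix.dotProduct_mulVec, Matrix.mulVec_mulVec, Matrix.mulVec_mulVec]
  rw [cfc_eq_dslope_dslope hB f a b, Matrix.add_mulVec, Matrix.add_mulVec, dotProduct_add,
    dotProduct_add, h3]
  simp only [Matrix.smul_mulVec, Matrix.sub_mulVec, Matrix.one_mulVec, dotProduct_smul,
    dotProduct_sub, smul_eq_mul]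
  ring

/-- The functional `M ↦ uᵀ M v`. -/
noncomputable def bilinEval {n : ℕ} (u v : Fin n → ℝ) : Matrix (Fin n) (Fin n) ℝ →L[ℝ] ℝ :=
  LinearMap.toContinuousLinearMap
    { toFun := fun M => u ⬝ᵥ M.mulVec v
      map_add' := fun M N => by rw [Matrix.add_mulVec, dotProduct_add]
      map_smul' := fun c M => by simp [Matrix.smul_mulVec] }

theorem hasDerivWithinAt_dotProduct_mulVec {n : ℕ} {γ : ℝ → Matrix (Fin n) (Fin n) ℝ}
    {X : Matrix (Fin n) (Fin n) ℝ} {s : Set ℝ} {t : ℝ} (h : HasDerivWithinAt γ X s t)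
    (u v : Fin n → ℝ) :
    HasDerivWithinAt (fun τ => u ⬝ᵥ (γ τ).mulVec v) (u ⬝ᵥ X.mulVec v) s t :=
  (bilinEval u v).hasFDerivAt.comp_hasDerivWithinAt t h

theorem eventually_norm_cfc_le {n : ℕ} {A : Matrix (Fin n) (Fin n) ℝ} (hA : A.PosDef)
    {g : ℝ → ℝ} (hg : ContinuousOn g (Set.Ioi 0)) :
    ∃ C, ∀ᶠ B in 𝓝 A, B.IsHermitian → ‖cfc g B‖ ≤ C := by
  obtain ⟨m, M, hm, hmM⟩ := exists_spectrum_subset_Icc_of_posDef hA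
  obtain ⟨C, hC⟩ := (isCompact_Icc (a := m) (b := M)).exists_bound_of_continuousOn
    (hg.mono fun x hx => hm.trans_le hx.1)
  refine ⟨max C 0, ?_⟩
  filter_upwards [hmM] with B hB hBh
  exact norm_cfc_le (le_max_right _ _) fun x hx => (hC x (hB hBh hx)).trans (le_max_left _ _)

theorem hasDerivWithinAt_sub_mul_cfc_mul_sub {n : ℕ} {γ : ℝ → Matrix (Fin n) (Fin n) ℝ}
    {X : Matrix (Fin n) (Fin n) ℝ} {s : Set ℝ} {t : ℝ} (hγ : ∀ τ ∈ s, (γ τ).PosDef) (ht : t ∈ s)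
    (h : HasDerivWithinAt γ X s t) {g : ℝ → ℝ} (hg : ContinuousOn g (Set.Ioi 0)) :
    HasDerivWithinAt (fun τ => (γ τ - γ t) * cfc g (γ τ) * (γ τ - γ t)) 0 s t := by
  obtain ⟨C, hC⟩ := eventually_norm_cfc_le (hγ t ht) hg
  have h1 : (fun τ => γ τ - γ t) =O[𝓝[s] t] fun τ => τ - t := h.hasFDerivWithinAt.isBigO_sub
  have h2 : (fun τ => cfc g (γ τ)) =O[𝓝[s] t] fun _ => (1 : ℝ) := by
    refine Asymptotics.IsBigO.of_bound C ?_
    filter_upwards [h.continuousWithinAt.eventually hC, self_mem_nhdsWithin] with τ h1 h2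
    simpa using h1 (hγ τ h2).1
  have h3 : (fun τ => τ - t) =o[𝓝[s] t] fun _ => (1 : ℝ) := by
    rw [Asymptotics.isLittleO_one_iff]
    have : ContinuousWithinAt (fun τ => τ - t) s t := by fun_prop
    simpa [ContinuousWithinAt] using this
  have h4 := ((h1.mul h2).mul h1).trans_isLittleO
    (((Asymptotics.isBigO_refl (fun τ : ℝ => τ - t) (𝓝[s] t)).mul
      (Asymptotics.isBigO_refl (fun _ => (1 : ℝ)) _)).mul_isLittleO h3)
  rw [hasDerivWithinAt_iff_isLittleO]
  simpa using h4

/-- First order perturbation of matrix powers: between eigenvectors for `a` and `b`, the derivative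
is multiplied by the divided difference of the scalar power at `a` and `b`. -/
theorem hasDerivWithinAt_dotProduct_rpow_mulVec {n : ℕ} {γ : ℝ → Matrix (Fin n) (Fin n) ℝ}
    {X : Matrix (Fin n) (Fin n) ℝ} {s : Set ℝ} {t : ℝ} (hγ : ∀ τ ∈ s, (γ τ).PosDef) (ht : t ∈ s)
    (h : HasDerivWithinAt γ X s t) (r : ℝ) {a b : ℝ} (hb : 0 < b) {u v : Fin n → ℝ}
    (hu : Matrix.vecMul u (γ t) = a • u) (hv : (γ t).mulVec v = b • v) :
    HasDerivWithinAt (fun τ => u ⬝ᵥ (γ τ ^ r).mulVec v)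
      (dslope (fun x : ℝ => x ^ r) a b * (u ⬝ᵥ X.mulVec v)) s t := by
  have hg := continuousOn_dslope_dslope (a := a) (s := Set.Ioi 0)
    (fun x hx => analyticAt_rpow_const hx r) hb
  have h1 := hasDerivWithinAt_dotProduct_mulVec
    (hasDerivWithinAt_sub_mul_cfc_mul_sub hγ ht h hg) u v
  have h2 := (((hasDerivWithinAt_dotProduct_mulVec h u v).const_mul
    (dslope (fun x : ℝ => x ^ r) a b)).const_add
      ((a ^ r - dslope (fun x : ℝ => x ^ r) a b * a) * (u ⬝ᵥ v))).add h1
  rw [Matrix.zero_mulVec, dotProduct_zero, add_zero] at h2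
  refine h2.congr_of_mem (fun τ hτ => ?_) ht
  rw [CFC.rpow_eq_cfc_real (Matrix.isStrictlyPositive_iff_posDef.mpr (hγ τ hτ)).nonneg]
  exact dotProduct_cfc_mulVec_eq (hγ τ hτ).1 (fun x : ℝ => x ^ r) hu hv

theorem exists_hasDerivWithinAt_rpow {n : ℕ} {γ : ℝ → Matrix (Fin n) (Fin n) ℝ}
    {X : Matrix (Fin n) (Fin n) ℝ} {s : Set ℝ} {t : ℝ} (hγ : ∀ τ ∈ s, (γ τ).PosDef) (ht : t ∈ s)
    (h : HasDerivWithinAt γ X s t) (r : ℝ) :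
    ∃ Y, HasDerivWithinAt (fun τ => γ τ ^ r) Y s t := by
  obtain ⟨G, hG, hGe⟩ := exists_analyticAt_eq_rpow (hγ t ht) r
  refine ⟨_, (hG.differentiableAt.hasFDerivAt.comp_hasDerivWithinAt t h).congr_of_eventuallyEq
    ?_ (hGe.self_of_nhds (hγ t ht))⟩
  filter_upwards [h.continuousWithinAt.eventually hGe, self_mem_nhdsWithin] with τ h1 h2
  exact h1 (hγ τ h2)

theorem continuousOn_rpow {α : Type*} [TopologicalSpace α] {n : ℕ}
    {γ : α → Matrix (Fin n) (Fin n) ℝ} {s : Set α} (hγ : ∀ τ ∈ s, (γ τ).PosDef)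
    (h : ContinuousOn γ s) (r : ℝ) : ContinuousOn (fun τ => γ τ ^ r) s := by
  intro t ht
  obtain ⟨G, hG, hGe⟩ := exists_analyticAt_eq_rpow (hγ t ht) r
  refine (hG.continuousAt.comp_continuousWithinAt (h t ht)).congr_of_eventuallyEq ?_
    (hGe.self_of_nhds (hγ t ht))
  filter_upwards [(h t ht).eventually hGe, self_mem_nhdsWithin] with τ h1 h2
  exact h1 (hγ τ h2)

theorem continuous_posDefPow (n : ℕ) (r : ℝ) : Continuous (posDefPow (n := n) r) :=
  Continuous.subtype_mk (continuousOn_univ.1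
    (continuousOn_rpow (fun A _ => A.2) continuous_subtype_val.continuousOn r)) _

/-- Working with entries makes the result independent of the matrix norm: the operator norm serves
here, the entrywise sup norm in `IsPiecewiseSmooth`. -/
theorem contDiffOn_rpow_entry {n : ℕ} {γ : ℝ → Matrix (Fin n) (Fin n) ℝ} {s : Set ℝ}
    (hγ : ∀ τ ∈ s, (γ τ).PosDef) (h : ∀ i j, ContDiffOn ℝ ∞ (fun τ => γ τ i j) s) (r : ℝ)
    (i j : Fin n) : ContDiffOn ℝ ∞ (fun τ => (γ τ ^ r) i j) s := by
  have hsmooth : ContDiffOn ℝ ∞ γ s := by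
    have : γ = fun τ => ∑ i, ∑ j, γ τ i j • Matrix.single i j (1 : ℝ) := by
      funext τ
      conv_lhs => rw [Matrix.matrix_eq_sum_single (γ τ)]
      simp
    rw [this]
    exact ContDiffOn.sum fun i _ => ContDiffOn.sum fun j _ => (h i j).smul contDiffOn_const
  intro t ht
  obtain ⟨G, hG, hGe⟩ := exists_analyticAt_eq_rpow (hγ t ht) r
  have h1 : ContDiffWithinAt ℝ ∞ (fun τ => γ τ ^ r) s t := by
    refine (hG.contDiffAt.comp_contDiffWithinAt t (hsmooth t ht)).congr_of_eventuallyEq ?_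
      (hGe.self_of_nhds (hγ t ht))
    filter_upwards [(hsmooth t ht).continuousWithinAt.eventually hGe, self_mem_nhdsWithin]
      with τ h1 h2
    exact h1 (hγ τ h2)
  let L : Matrix (Fin n) (Fin n) ℝ →L[ℝ] ℝ :=
    LinearMap.toContinuousLinearMap (Matrix.entryLinearMap ℝ ℝ i j)
  exact L.contDiff.contDiffAt.comp_contDiffWithinAt t h1

end PowerDerivative

/-! ### The scalar inequality for divided differences -/

section ScalarInequality

/-- `sinh` is convex on the nonnegative half-line and vanishes at 0, so it lies below its chords
from the origin. -/
theorem sinh_mul_le {r z : ℝ} (hr0 : 0 ≤ r) (hr1 : r ≤ 1) (hz : 0 ≤ z) :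
    Real.sinh (r * z) ≤ r * Real.sinh z := by
  have hconv : ConvexOn ℝ (Set.Ici 0) Real.sinh := by
    refine MonotoneOn.convexOn_of_deriv (convex_Ici 0) Real.continuous_sinh.continuousOn
      Real.differentiable_sinh.differentiableOn ?_
    rw [Real.deriv_sinh, interior_Ici]
    intro x hx y hy hxy
    rw [Real.cosh_le_cosh, abs_of_pos hx, abs_of_pos hy]
    exact hxy
  simpa using hconv.2 (Set.self_mem_Ici (a := (0 : ℝ))) hz (sub_nonneg.2 hr1) hr0 (by ring)

theorem sinh_mul_sq_le {r : ℝ} (hr0 : 0 ≤ r) (hr1 : r ≤ 1) (z : ℝ) :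
    Real.sinh (r * z) ^ 2 ≤ r ^ 2 * Real.sinh z ^ 2 := by
  wlog hz : 0 ≤ z generalizing z
  · simpa using this (-z) (by linarith)
  rw [← mul_pow]
  exact pow_le_pow_left₀ (Real.sinh_nonneg_iff.2 (mul_nonneg hr0 hz)) (sinh_mul_le hr0 hr1 hz) 2

theorem exp_sub_exp_sq_div (x y : ℝ) :
    (Real.exp x - Real.exp y) ^ 2 / (Real.exp x * Real.exp y) =
      4 * Real.sinh ((x - y) / 2) ^ 2 := by
  have hx : Real.exp x = Real.exp ((x + y) / 2) * Real.exp ((x - y) / 2) := by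
    rw [← Real.exp_add]; ring_nf
  have hy : Real.exp y = Real.exp ((x + y) / 2) * Real.exp (-((x - y) / 2)) := by
    rw [← Real.exp_add]; ring_nf
  have h1 : Real.exp x * Real.exp y = Real.exp ((x + y) / 2) ^ 2 := by
    rw [← Real.exp_add, ← Real.exp_nat_mul]; congr 1; push_cast; ring
  rw [h1, Real.sinh_eq, hx, hy]
  field_simp
  ring

theorem rpow_sub_rpow_sq_div_le {a b r : ℝ} (ha : 0 < a) (hb : 0 < b) (hr0 : 0 ≤ r) (hr1 : r ≤ 1) :
    (a ^ r - b ^ r) ^ 2 / (a ^ r * b ^ r) ≤ r ^ 2 * ((a - b) ^ 2 / (a * b)) := by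
  have h1 := exp_sub_exp_sq_div (Real.log a * r) (Real.log b * r)
  have h2 := exp_sub_exp_sq_div (Real.log a) (Real.log b)
  rw [← Real.rpow_def_of_pos ha, ← Real.rpow_def_of_pos hb] at h1
  rw [Real.exp_log ha, Real.exp_log hb] at h2
  rw [h1, h2]
  have h3 := sinh_mul_sq_le hr0 hr1 ((Real.log a - Real.log b) / 2)
  rw [show (Real.log a * r - Real.log b * r) / 2 = r * ((Real.log a - Real.log b) / 2) by ring]
  linarith

theorem dslope_rpow_self {a : ℝ} (ha : 0 < a) (r : ℝ) :
    dslope (fun x : ℝ => x ^ r) a a = r * (a ^ r / a) := by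
  rw [dslope_same, Real.deriv_rpow_const, Real.rpow_sub_one ha.ne']

theorem dslope_comm (f : ℝ → ℝ) (a b : ℝ) : dslope f a b = dslope f b a := by
  rcases eq_or_ne a b with rfl | h
  · rfl
  · rw [dslope_of_ne f h, dslope_of_ne f h.symm, slope_comm]

theorem dslope_rpow_sq_div_le {a b r : ℝ} (ha : 0 < a) (hb : 0 < b) (hr0 : 0 ≤ r) (hr1 : r ≤ 1) :
    dslope (fun x : ℝ => x ^ r) a b ^ 2 / (a ^ r * b ^ r) ≤ r ^ 2 / (a * b) := by
  rcases eq_or_ne a b with rfl | hab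
  · rw [dslope_rpow_self ha]
    have : 0 < a ^ r := Real.rpow_pos_of_pos ha r
    refine le_of_eq ?_
    field_simp
  · have h1 := rpow_sub_rpow_sq_div_le ha hb hr0 hr1
    have h2 := sub_smul_dslope (fun x : ℝ => x ^ r) a b
    simp only [smul_eq_mul] at h2
    have h3 : 0 < (a - b) ^ 2 := by
      have := sub_ne_zero.2 hab
      positivity
    have h4 : (a ^ r - b ^ r) ^ 2 = (a - b) ^ 2 * dslope (fun x : ℝ => x ^ r) a b ^ 2 := by
      linear_combination (-(b - a) * dslope (fun x : ℝ => x ^ r) a b - (b ^ r - a ^ r)) * h2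
    rw [h4, mul_div_assoc, show r ^ 2 * ((a - b) ^ 2 / (a * b)) =
      (a - b) ^ 2 * (r ^ 2 / (a * b)) by ring] at h1
    exact le_of_mul_le_mul_left h1 h3

end ScalarInequality

/-! ### Invariance of the cone field and of the orders -/

section Cone

open scoped MatrixOrder
open Matrix

theorem trace_inv_mul_of_diagonalized {n : ℕ} {P W : Matrix (Fin n) (Fin n) ℝ} {d : Fin n → ℝ}
    (hW : W * Wᵀ = 1) (hd : ∀ i, d i ≠ 0) (hP : P = W * diagonal d * Wᵀ)
    (X : Matrix (Fin n) (Fin n) ℝ) :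
    (P⁻¹ * X).trace = ∑ i, (Wᵀ * X * W) i i / d i ∧
      (P⁻¹ * X * P⁻¹ * X).trace =
        ∑ i, ∑ j, (Wᵀ * X * W) i j * (Wᵀ * X * W) j i / (d i * d j) := by
  have hW' : Wᵀ * W = 1 := mul_eq_one_comm.1 hW
  have hinv : P⁻¹ = W * diagonal (fun i => (d i)⁻¹) * Wᵀ := by
    refine inv_eq_right_inv ?_
    calc P * (W * diagonal (fun i => (d i)⁻¹) * Wᵀ)
        = W * diagonal d * (Wᵀ * W) * diagonal (fun i => (d i)⁻¹) * Wᵀ := by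
          rw [hP]; simp only [Matrix.mul_assoc]
      _ = 1 := by
          rw [hW', Matrix.mul_one, Matrix.mul_assoc W, diagonal_mul_diagonal]
          simp [hd, hW]
  set D := diagonal (fun i => (d i)⁻¹) with hD
  have h1 : (P⁻¹ * X).trace = (D * (Wᵀ * X * W)).trace := by
    rw [hinv, Matrix.mul_assoc, Matrix.mul_assoc, trace_mul_comm W]
    simp only [Matrix.mul_assoc]
  have h2 : (P⁻¹ * X * P⁻¹ * X).trace = (D * (Wᵀ * X * W) * (D * (Wᵀ * X * W))).trace := by
    rw [hinv]
    simp only [Matrix.mul_assoc]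
    rw [trace_mul_comm W]
    simp only [Matrix.mul_assoc]
  rw [h1, h2]
  constructor
  · simp [hD, trace, diagonal_mul, div_eq_inv_mul]
  · simp only [trace, diag_apply]
    refine Finset.sum_congr rfl fun i _ => ?_
    rw [Matrix.mul_apply]
    refine Finset.sum_congr rfl fun j _ => ?_
    rw [hD, diagonal_mul, diagonal_mul, div_eq_mul_inv, mul_inv]
    ring

theorem mem_quadraticConeField_rpow {n : ℕ} {μ r : ℝ} (hμ : 0 ≤ μ) (hr0 : 0 ≤ r) (hr1 : r ≤ 1)
    (A : PosDefMatrix n) {X Y : Matrix (Fin n) (Fin n) ℝ} (hX : X ∈ quadraticConeField n μ A)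
    (hXY : ∀ (a b : ℝ) (u v : Fin n → ℝ), 0 < b → vecMul u A.1 = a • u → A.1 *ᵥ v = b • v →
      u ⬝ᵥ Y *ᵥ v = dslope (fun x : ℝ => x ^ r) a b * (u ⬝ᵥ X *ᵥ v)) :
    Y ∈ quadraticConeField n μ (posDefPow r A) := by
  obtain ⟨A, hA⟩ := A
  obtain ⟨hXs, hX1, hX2⟩ := hX
  simp only at hXY hX1 hX2
  set W : Matrix (Fin n) (Fin n) ℝ := (hA.1.eigenvectorUnitary).1
  set d := hA.1.eigenvalues
  have hd : ∀ i, 0 < d i := hA.eigenvalues_pos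
  have hW : W * Wᵀ = 1 := by
    have := Unitary.mul_star_self_of_mem hA.1.eigenvectorUnitary.2
    rwa [star_eq_conjTranspose, conjTranspose_eq_transpose_of_trivial] at this
  have hW' : Wᵀ * W = 1 := mul_eq_one_comm.1 hW
  have hAW : A = W * diagonal d * Wᵀ := by
    have := hA.1.spectral_theorem
    rwa [Unitary.conjStarAlgAut_apply, star_eq_conjTranspose,
      conjTranspose_eq_transpose_of_trivial] at this
  have hArW : A ^ r = W * diagonal (fun i => d i ^ r) * Wᵀ := by
    rw [CFC.rpow_eq_cfc_real (Matrix.isStrictlyPositive_iff_posDef.mpr hA).nonneg, hA.1.cfc_eq,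
      Matrix.IsHermitian.cfc, Unitary.conjStarAlgAut_apply, star_eq_conjTranspose,
      conjTranspose_eq_transpose_of_trivial]
    rfl
  have hAT : Aᵀ = A := by
    have := hA.1
    rwa [IsHermitian, conjTranspose_eq_transpose_of_trivial] at this
  have hcol : ∀ j, A *ᵥ W.col j = d j • W.col j := fun j => by
    have h1 : A * W = W * diagonal d := by
      rw [hAW, Matrix.mul_assoc, hW', Matrix.mul_one]
    ext i
    have := congrFun (congrFun h1 i) j
    rw [mul_diagonal] at this
    simpa [mul_comm, Matrix.mul_apply, mulVec, dotProduct] using this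
  have hrow : ∀ j, vecMul (W.col j) A = d j • W.col j := fun j => by
    rw [← mulVec_transpose, hAT, hcol]
  have hentry : ∀ (Z : Matrix (Fin n) (Fin n) ℝ) i j,
      (Wᵀ * Z * W) i j = W.col i ⬝ᵥ Z *ᵥ W.col j := fun Z i j => by
    rw [dotProduct_mulVec]
    simp [Matrix.mul_apply, vecMul, dotProduct]
  have hy : ∀ i j, (Wᵀ * Y * W) i j =
      dslope (fun x : ℝ => x ^ r) (d i) (d j) * (Wᵀ * X * W) i j := fun i j => by
    rw [hentry, hentry]
    exact hXY _ _ _ _ (hd j) (hrow i) (hcol j)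
  have hxs : ∀ i j, (Wᵀ * X * W) j i = (Wᵀ * X * W) i j := fun i j => by
    have : (Wᵀ * X * W)ᵀ = Wᵀ * X * W := by
      rw [transpose_mul, transpose_mul, transpose_transpose, hXs.eq, Matrix.mul_assoc]
    exact congrFun (congrFun this i) j
  obtain ⟨tX1, tX2⟩ := trace_inv_mul_of_diagonalized hW (fun i => (hd i).ne') hAW X
  obtain ⟨tY1, tY2⟩ := trace_inv_mul_of_diagonalized hW
    (fun i => (Real.rpow_pos_of_pos (hd i) r).ne') hArW Y
  have htr : ((A ^ r)⁻¹ * Y).trace = r * (A⁻¹ * X).trace := by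
    rw [tX1, tY1, Finset.mul_sum]
    refine Finset.sum_congr rfl fun i _ => ?_
    rw [hy, dslope_rpow_self (hd i)]
    have := (Real.rpow_pos_of_pos (hd i) r).ne'
    have := (hd i).ne'
    field_simp
  have hquad : ((A ^ r)⁻¹ * Y * (A ^ r)⁻¹ * Y).trace ≤ r ^ 2 * (A⁻¹ * X * A⁻¹ * X).trace := by
    rw [tX2, tY2, Finset.mul_sum]
    refine Finset.sum_le_sum fun i _ => ?_
    rw [Finset.mul_sum]
    refine Finset.sum_le_sum fun j _ => ?_
    rw [hy, hy, hxs i j, dslope_comm _ (d j)]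
    have := mul_le_mul_of_nonneg_right (dslope_rpow_sq_div_le (hd i) (hd j) hr0 hr1)
      (sq_nonneg ((Wᵀ * X * W) i j))
    calc _ = _ := by ring
      _ ≤ _ := this
      _ = _ := by ring
  refine ⟨?_, ?_, ?_⟩
  · have h1 : Y = W * (Wᵀ * Y * W) * Wᵀ := by
      rw [← Matrix.mul_assoc, ← Matrix.mul_assoc, hW, Matrix.one_mul, Matrix.mul_assoc, hW,
        Matrix.mul_one]
    have h2 : (Wᵀ * Y * W)ᵀ = Wᵀ * Y * W := by
      ext i j
      rw [transpose_apply, hy, hy, hxs, dslope_comm]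
    rw [IsSymm, h1, transpose_mul, transpose_mul, h2, transpose_transpose]
    simp only [Matrix.mul_assoc]
  · change 0 ≤ ((A ^ r)⁻¹ * Y).trace ^ 2 - μ * ((A ^ r)⁻¹ * Y * (A ^ r)⁻¹ * Y).trace
    rw [htr]
    have h1 := mul_le_mul_of_nonneg_left hquad hμ
    have h2 := mul_nonneg (sq_nonneg r) hX1
    linarith
  · change 0 ≤ ((A ^ r)⁻¹ * Y).trace
    rw [htr]
    exact mul_nonneg hr0 hX2

theorem zero_mem_quadraticConeField (n : ℕ) (μ : ℝ) (A : PosDefMatrix n) :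
    0 ∈ quadraticConeField n μ A := by
  simp [quadraticConeField]

theorem isPiecewiseSmooth_rpow {n : ℕ} {γ : ℝ → Matrix (Fin n) (Fin n) ℝ}
    (hγ : ∀ t ∈ Set.Icc (0 : ℝ) 1, (γ t).PosDef) (h : IsPiecewiseSmooth γ) (r : ℝ) :
    IsPiecewiseSmooth fun t => γ t ^ r := by
  obtain ⟨hcont, k, t, hmono, ht0, htk, hsmooth⟩ := h
  refine ⟨continuousOn_rpow hγ hcont r, k, t, hmono, ht0, htk, fun i hi => ?_⟩
  have hsub : Set.Icc (t i) (t (i + 1)) ⊆ Set.Icc 0 1 :=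
    Set.Icc_subset_Icc (ht0 ▸ hmono (Nat.zero_le i)) (htk ▸ hmono hi)
  have hentry : ∀ a b, ContDiffOn ℝ ∞ (fun τ => γ τ a b) (Set.Icc (t i) (t (i + 1))) :=
    fun a b => contDiffOn_pi.1 (contDiffOn_pi.1 (hsmooth i hi) a) b
  exact contDiffOn_pi.2 fun a => contDiffOn_pi.2 fun b =>
    contDiffOn_rpow_entry (fun τ hτ => hγ τ (hsub hτ)) hentry r a b

open scoped Matrix.Norms.L2Operator in
theorem isConalCurve_rpow {n : ℕ} {μ r : ℝ} (hμ : 0 ≤ μ) (hr0 : 0 ≤ r) (hr1 : r ≤ 1)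
    {γ : ℝ → Matrix (Fin n) (Fin n) ℝ} (h : IsConalCurve (quadraticConeField n μ) γ) :
    IsConalCurve (quadraticConeField n μ) fun t => γ t ^ r := by
  obtain ⟨hsmooth, hcone⟩ := h
  have hγ : ∀ t ∈ Set.Icc (0 : ℝ) 1, (γ t).PosDef := fun t ht => (hcone t ht).1
  refine ⟨isPiecewiseSmooth_rpow hγ hsmooth r, fun t ht =>
    ⟨posDef_rpow (hγ t ht) r, fun Y hY => ?_⟩⟩
  have huniq : UniqueDiffWithinAt ℝ (Set.Icc (0 : ℝ) 1) t := uniqueDiffOn_Icc_zero_one t ht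
  -- For `r = 0` the image curve is constantly 1, and the power map cannot be inverted.
  rcases hr0.eq_or_lt with rfl | hr
  · have h1 : HasDerivWithinAt (fun τ => γ τ ^ (0 : ℝ)) 0 (Set.Icc 0 1) t :=
      (hasDerivWithinAt_const t _ (1 : Matrix (Fin n) (Fin n) ℝ)).congr_of_mem (fun τ hτ =>
        CFC.rpow_zero _ (Matrix.isStrictlyPositive_iff_posDef.mpr (hγ τ hτ)).nonneg) ht
    rw [huniq.eq_deriv _ hY h1]
    exact zero_mem_quadraticConeField n μ _
  -- Only `γ ^ r` is known to be differentiable at `t`, while the cone hypothesis concerns `γ`.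
  -- Taking the power `r⁻¹` recovers a derivative of `γ`.
  · obtain ⟨X, hX⟩ := exists_hasDerivWithinAt_rpow (fun τ hτ => posDef_rpow (hγ τ hτ) r) ht hY r⁻¹
    have hX' : HasDerivWithinAt γ X (Set.Icc 0 1) t := hX.congr_of_mem (fun τ hτ =>
      (CFC.rpow_rpow_inv _ r hr.ne' (Matrix.isStrictlyPositive_iff_posDef.mpr (hγ τ hτ))).symm) ht
    refine mem_quadraticConeField_rpow hμ hr0 hr1 ⟨γ t, hγ t ht⟩ ((hcone t ht).2 X hX') ?_
    intro a b u v hb hu hv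
    exact huniq.eq_deriv _ (hasDerivWithinAt_dotProduct_mulVec hY u v)
      (hasDerivWithinAt_dotProduct_rpow_mulVec hγ ht hX' r hb hu hv)

theorem conalLE_posDefPow {n : ℕ} {μ r : ℝ} (hμ : 0 ≤ μ) (hr0 : 0 ≤ r) (hr1 : r ≤ 1)
    {A B : PosDefMatrix n} (h : ConalLE (quadraticConeField n μ) A B) :
    ConalLE (quadraticConeField n μ) (posDefPow r A) (posDefPow r B) := by
  obtain ⟨γ, hγ, h0, h1⟩ := h
  exact ⟨fun t => γ t ^ r, isConalCurve_rpow hμ hr0 hr1 hγ, by simp [h0, posDefPow],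
    by simp [h1, posDefPow]⟩

end Cone

theorem mainTheorem1 (n : ℕ) (μ : ℝ) (hμ_pos : 0 < μ) (hμ_lt : μ < n)
    (r : ℝ) (hr_nonneg : 0 ≤ r) (hr_le : r ≤ 1) :
    (∀ A B : PosDefMatrix n, ConalLE (quadraticConeField n μ) A B →
      ConalLE (quadraticConeField n μ) (posDefPow r A) (posDefPow r B)) ∧
    (∀ A B : PosDefMatrix n, ClosedConalLE (quadraticConeField n μ) A B →
      ClosedConalLE (quadraticConeField n μ) (posDefPow r A) (posDefPow r B)) := by
  refine ⟨fun A B h => conalLE_posDefPow hμ_pos.le hr_nonneg hr_le h, fun A B h => ?_⟩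
  exact map_mem_closure (continuous_posDefPow n r) h fun Z hZ =>
    conalLE_posDefPow hμ_pos.le hr_nonneg hr_le hZ
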